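/- **Setting.** All sets are finite. $\mathrm{SubStoch}$ is the process theory of substochastic maps between finite sets ($S(y|x)\ge 0$, $\sum_y S(y|x)\le 1$; *stochastic* if all these sums are $1$); a partial function $X\rightharpoonup Y$ is regarded as the substochastic map with entries $1$ where it is defined and takes the given value, and $0$ otherwise. $[\Lambda\to\Lambda']$ is the set of functions from $\Lambda$ to $\Lambda'$. *The classical realist causal-inferential theory $\mathrm{F\text{-}S}$.* Systems are finite parallel composites of causal systems (finite sets $\Lambda$ of ontic states) and inferential systems (finite sets $X$). A diagram is any sequential and parallel composite of wirings, of substochastic maps between inferential systems, and of three kinds of generators: $k_{\Lambda,\Lambda'}$, with an inferential input $[\Lambda\to\Lambda']$, a causal input $\Lambda$ and a causal output $\Lambda'$ (the causal dynamics is the function about which one has knowledge); $\ell_\Lambda$, with causal input $\Lambda$, an inferential output $\Lambda$ and a causal output $\Lambda$ (learning about $\Lambda$); and $u_\Lambda$, with causal input $\Lambda$ and no output (ignoring $\Lambda$). Processes are diagrams modulo the congruence generated by the laws of symmetric monoidal categories, by the functoriality of the inclusion $\mathbf{i}'$ of $\mathrm{SubStoch}$ (including the identification of a composite wire with its component wires),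 and by the following rules. 1. Composing in sequence (in parallel) two boxes $k$ with inputs $g$ and $f$ equals one box $k$ whose input is obtained from $g,f$ by the deterministic map to $g\circ f$ (to $f\times g$); $k$ with the point distribution on an identity, a swap, an associator or a unitor is that wiring. 2. $\ell_\Lambda$ followed by marginalizing its inferential output is the identity; $\ell_\Lambda$ twice in succession equals $\ell_\Lambda$ followed by copying its inferential output; $\ell_{\Lambda\times\mathrm M}$ is $\ell_\Lambda$ and $\ell_{\mathrm M}$ in parallel. 3. $u_{\Lambda\times\mathrm M}$ is $u_\Lambda$ and $u_{\mathrm M}$ in parallel; $u$ on the trivial system is trivial; $k_{\Lambda,\Lambda'}$ followed by $u_{\Lambda'}$ is marginalization of $[\Lambda\to\Lambda']$ in parallel with $u_\Lambda$. 4. $k_{\Lambda,\Lambda'}$ followed by $\ell_{\Lambda'}$ equals: copy the input $f\in[\Lambda\to\Lambda']$, apply $\ell_\Lambda$ to the causal input, apply $k_{\Lambda,\Lambda'}$ to one copy and to the causal wire, and compute the inferential output $f(\lambda)$ from the other copy and from the learned $\lambda$. A process is *causally closed* if it has only inferential inputs and outputs. A prediction map $\mathbf p^*$ is a diagram-preserving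 map from causally closed processes to $\mathrm{SubStoch}$ with $\mathbf p^*\circ\mathbf i'=\mathrm{id}$. Processes $\mathcal D,\mathcal E:A\to B$ are *inferentially equivalent*, $\mathcal D\sim_{\mathbf p^*}\mathcal E$, if for every auxiliary system $W$ and all processes $x:U\to A\otimes W$ and $y:B\otimes W\to V$ with $U,V$ inferential, $\mathbf p^*\big(y\circ(\mathcal D\otimes 1_W)\circ x\big)=\mathbf p^*\big(y\circ(\mathcal E\otimes 1_W)\circ x\big)$. The quotiented theory $\widetilde{\mathrm{F\text{-}S}}$ is $\mathrm{F\text{-}S}$ modulo $\sim_{\mathbf p^*}$. **Theorem.** Let $\mathbf p^*$ be a prediction map and let $A,B$ be systems of $\mathrm{F\text{-}S}$. Let $X$ and $\Lambda$ be the products of all the inferential, respectively causal, systems in $A$, and $Y$ and $\Lambda'$ those in $B$; suppose that $\Lambda'\neq\emptyset$ if $\Lambda\neq\emptyset$. Then for every process (diagram) $\mathcal D:A\to B$ of $\mathrm{F\text{-}S}$ there are a finite set $Z$, a stochastic map $\Sigma$ from $X$ to $Z\times[\Lambda\to\Lambda']$ and a propositional map $\Pi$ from $Z\times\Lambda$ to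 $Y$ (a partial function) such that $\mathcal D$ is inferentially equivalent to the normal form $$\big(\Pi\otimes k_{\Lambda,\Lambda'}\big)\circ\big(1_Z\otimes\mathrm{swap}\otimes 1_\Lambda\big)\circ\big(\Sigma\otimes \ell_\Lambda\big):\;X\otimes\Lambda\to Y\otimes\Lambda',$$ in which the causal input $\Lambda$ is first learned and then subjected to the function supplied by $\Sigma$, and $\Pi$ computes the inferential output from $Z$ and from what was learned (the wires of $A$ and of $B$ being gathered into $X\otimes\Lambda$ and $Y\otimes\Lambda'$). **Corollary.** Under the same assumption on $A$ and $B$, every process $\mathcal D:A\to B$ of $\widetilde{\mathrm{F\text{-}S}}$ is equal, in $\widetilde{\mathrm{F\text{-}S}}$, to such a normal form. -/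

import Mathlib

open CategoryTheory MonoidalCategory
open scoped NNReal

namespace CausalInf

/-! ### Finite sets and substochastic maps -/

/-- A finite set, the type label of a system. -/
structure FinSpace : Type 1 where
  carrier : Type
  [fintype : Fintype carrier]
  [decEq : DecidableEq carrier]

namespace FinSpace

instance : CoeSort FinSpace Type := ⟨carrier⟩
instance (X : FinSpace) : Fintype X := X.fintype
instance (X : FinSpace) : DecidableEq X := X.decEq

/-- The singleton set. -/
def star : FinSpace := ⟨PUnit⟩
/-- The Cartesian product. -/
def prod (X Y : FinSpace) : FinSpace := ⟨X × Y⟩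
/-- The set of all functions from `X` to `Y`. -/
def fn (X Y : FinSpace) : FinSpace := ⟨X → Y⟩

end FinSpace

open FinSpace

/-- A substochastic map from `X` to `Y`; `val x y` is the weight of `y` given `x`. -/
@[ext]
structure SubStoch (X Y : FinSpace) where
  val : X → Y → ℝ≥0
  sum_le : ∀ x, ∑ y, val x y ≤ 1

namespace SubStoch

/-- A stochastic map is a normalized substochastic map. -/
def IsStochastic {X Y : FinSpace} (S : SubStoch X Y) : Prop := ∀ x, ∑ y, S.val x y = 1

/-- The substochastic map that represents a partial function. -/
def ofPartial {X Y : FinSpace} (f : X → Option Y) : SubStoch X Y where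
  val x y := if f x = some y then 1 else 0
  sum_le x := by
    cases h : f x with
    | none => simp
    | some a => simp

/-- The deterministic stochastic map that represents a function. -/
def det {X Y : FinSpace} (f : X → Y) : SubStoch X Y where
  val x y := if f x = y then 1 else 0
  sum_le x := by simp

/-- The identity. -/
def id (X : FinSpace) : SubStoch X X := det fun x => x

/-- Sequential composition, `S` first. -/
def comp {X Y Z : FinSpace} (S : SubStoch X Y) (T : SubStoch Y Z) : SubStoch X Z where
  val x z := ∑ y, S.val x y * T.val y z
  sum_le x := by
    rw [Finset.sum_comm]
    refine le_trans (Finset.sum_le_sum fun y _ => ?_) (S.sum_le x)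
    rw [← Finset.mul_sum]
    exact mul_le_of_le_one_right zero_le (T.sum_le y)

/-- Parallel composition. -/
def tensor {X Y X' Y' : FinSpace} (S : SubStoch X Y) (T : SubStoch X' Y') :
    SubStoch (X.prod X') (Y.prod Y') where
  val x y := S.val x.1 y.1 * T.val x.2 y.2
  sum_le x := by
    change ∑ y : Y × Y', _ ≤ _
    rw [Fintype.sum_prod_type]
    simp only [← Finset.mul_sum, ← Finset.sum_mul]
    exact mul_le_one' (S.sum_le _) (T.sum_le _)

/-- The associator. -/
def assoc (X Y Z : FinSpace) : SubStoch ((X.prod Y).prod Z) (X.prod (Y.prod Z)) :=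
  det fun p => (p.1.1, (p.1.2, p.2))

/-- The left unitor. -/
def leftUnitor (X : FinSpace) : SubStoch (star.prod X) X := det fun p => p.2

/-- The right unitor. -/
def rightUnitor (X : FinSpace) : SubStoch (X.prod star) X := det fun p => p.1

/-- The swap. -/
def swap (X Y : FinSpace) : SubStoch (X.prod Y) (Y.prod X) := det fun p => (p.2, p.1)

/-- The point distribution on `x`. -/
def point {X : FinSpace} (x : X) : SubStoch star X := det fun _ => x

/-- The copy (broadcasting) map. -/
def copy (X : FinSpace) : SubStoch X (X.prod X) := det fun x => (x, x)

/-- Marginalization, which is also the tautological effect. -/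
def discard (X : FinSpace) : SubStoch X star := det fun _ => PUnit.unit

/-- Knowledge about `g` and about `f` is turned into knowledge about `g ∘ f`. -/
def seqComp (X Y Z : FinSpace) : SubStoch ((fn Y Z).prod (fn X Y)) (fn X Z) :=
  det fun p x => p.1 (p.2 x)

/-- Knowledge about `f` and about `g` is turned into knowledge about `f × g`. -/
def parComp (X Y X' Y' : FinSpace) :
    SubStoch ((fn X Y).prod (fn X' Y')) (fn (X.prod X') (Y.prod Y')) :=
  det fun p x => (p.1 x.1, p.2 x.2)

/-- Knowledge about `f` and about its argument is turned into knowledge about the value. -/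
def funcApp (X Y : FinSpace) : SubStoch ((fn X Y).prod X) Y := det fun p => p.1 p.2

end SubStoch

/-! ### Systems and diagrams -/

/-- Systems of a causal-inferential theory of functional dynamics: finite parallel composites of
causal systems (ontic state spaces) and inferential systems. -/
inductive Sys : Type 1
  | unit : Sys
  | inf (X : FinSpace) : Sys
  | caus (L : FinSpace) : Sys
  | tensor (A B : Sys) : Sys

namespace Sys

/-- The product of all the inferential systems in `A`. -/
def infPart : Sys → FinSpace
  | unit => star
  | inf X => X
  | caus _ => star
  | tensor A B => (infPart A).prod (infPart B)

/-- The product of all the causal systems in `A`. -/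
def causPart : Sys → FinSpace
  | unit => star
  | inf _ => star
  | caus L => L
  | tensor A B => (causPart A).prod (causPart B)

/-- No causal system occurs in `A`. -/
def IsInferential : Sys → Prop
  | unit => True
  | inf _ => True
  | caus _ => False
  | tensor A B => IsInferential A ∧ IsInferential B

end Sys

/-- Diagrams: formal sequential and parallel composites of wirings, of substochastic maps between
inferential systems, and of the three generators `know`, `learn` and `ignore`.
The constructors `infSplit`, …, `causUnitInv` only change the way in which a composite system is
drawn: as one wire or as several. -/
inductive Diag : Sys → Sys → Type 1
  | id (A : Sys) : Diag A A
  | comp {A B C : Sys} (f : Diag A B) (g : Diag B C) : Diag A C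
  | tensor {A B A' B' : Sys} (f : Diag A B) (g : Diag A' B') :
      Diag (A.tensor A') (B.tensor B')
  | assoc (A B C : Sys) : Diag ((A.tensor B).tensor C) (A.tensor (B.tensor C))
  | assocInv (A B C : Sys) : Diag (A.tensor (B.tensor C)) ((A.tensor B).tensor C)
  | leftUnitor (A : Sys) : Diag (Sys.unit.tensor A) A
  | leftUnitorInv (A : Sys) : Diag A (Sys.unit.tensor A)
  | rightUnitor (A : Sys) : Diag (A.tensor Sys.unit) A
  | rightUnitorInv (A : Sys) : Diag A (A.tensor Sys.unit)
  | swap (A B : Sys) : Diag (A.tensor B) (B.tensor A)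
  | infSplit (X Y : FinSpace) : Diag (.inf (X.prod Y)) ((Sys.inf X).tensor (.inf Y))
  | infMerge (X Y : FinSpace) : Diag ((Sys.inf X).tensor (.inf Y)) (.inf (X.prod Y))
  | infUnit : Diag (.inf star) .unit
  | infUnitInv : Diag .unit (.inf star)
  | causSplit (L M : FinSpace) : Diag (.caus (L.prod M)) ((Sys.caus L).tensor (.caus M))
  | causMerge (L M : FinSpace) : Diag ((Sys.caus L).tensor (.caus M)) (.caus (L.prod M))
  | causUnit : Diag (.caus star) .unit
  | causUnitInv : Diag .unit (.caus star)
  /-- a process of the inferential theory -/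
  | infer {X Y : FinSpace} (S : SubStoch X Y) : Diag (.inf X) (.inf Y)
  /-- the causal dynamics from `L` to `M` is the function about which one has knowledge on the
  inferential input -/
  | know (L M : FinSpace) : Diag ((Sys.inf (fn L M)).tensor (.caus L)) (.caus M)
  /-- gain knowledge about a causal system -/
  | learn (L : FinSpace) : Diag (.caus L) ((Sys.inf L).tensor (.caus L))
  /-- ignore a causal system -/
  | ignore (L : FinSpace) : Diag (.caus L) .unit

namespace Diag

local infixr:80 " ⊚ " => Diag.comp
local infixr:85 " ⊠ " => Diag.tensor

/-- The wiring that exchanges the two middle systems of four. -/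
def midSwap (A B C D : Sys) :
    Diag ((A.tensor B).tensor (C.tensor D)) ((A.tensor C).tensor (B.tensor D)) :=
  assoc A B (C.tensor D) ⊚ (id A ⊠ assocInv B C D) ⊚ (id A ⊠ (swap B C ⊠ id D)) ⊚
    (id A ⊠ assoc C B D) ⊚ assocInv A C (B.tensor D)

/-- Marginalization of an inferential system. -/
def discard (X : FinSpace) : Diag (.inf X) .unit := infer (SubStoch.discard X) ⊚ infUnit

/-- The embedding of a function as a causal process, by means of the point distribution. -/
def embed {L M : FinSpace} (f : L → M) : Diag (.caus L) (.caus M) :=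
  leftUnitorInv _ ⊚ ((infUnitInv ⊚ infer (SubStoch.point (X := fn L M) f)) ⊠ id _) ⊚ know L M

/-- The rewrite rules: the smallest congruence on diagrams that contains the laws of symmetric
monoidal categories, the functoriality of the inclusion of substochastic maps, and the constraints
on the three generators. -/
inductive Rw : ∀ {A B : Sys}, Diag A B → Diag A B → Prop
  -- congruence
  | refl {A B} (f : Diag A B) : Rw f f
  | symm {A B} {f g : Diag A B} : Rw f g → Rw g f
  | trans {A B} {f g h : Diag A B} : Rw f g → Rw g h → Rw f h
  | comp_congr {A B C} {f f' : Diag A B} {g g' : Diag B C} :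
      Rw f f' → Rw g g' → Rw (f ⊚ g) (f' ⊚ g')
  | tensor_congr {A B A' B'} {f f' : Diag A B} {g g' : Diag A' B'} :
      Rw f f' → Rw g g' → Rw (f ⊠ g) (f' ⊠ g')
  -- symmetric monoidal categories
  | id_comp {A B} (f : Diag A B) : Rw (id A ⊚ f) f
  | comp_id {A B} (f : Diag A B) : Rw (f ⊚ id B) f
  | comp_assoc {A B C D} (f : Diag A B) (g : Diag B C) (h : Diag C D) :
      Rw ((f ⊚ g) ⊚ h) (f ⊚ g ⊚ h)
  | tensor_id (A B) : Rw (id A ⊠ id B) (id (A.tensor B))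
  | tensor_comp {A B C A' B' C'} (f : Diag A B) (f' : Diag A' B') (g : Diag B C)
      (g' : Diag B' C') : Rw ((f ⊠ f') ⊚ (g ⊠ g')) ((f ⊚ g) ⊠ (f' ⊚ g'))
  | assoc_inv (A B C) : Rw (assoc A B C ⊚ assocInv A B C) (id _)
  | inv_assoc (A B C) : Rw (assocInv A B C ⊚ assoc A B C) (id _)
  | leftUnitor_inv (A) : Rw (leftUnitor A ⊚ leftUnitorInv A) (id _)
  | inv_leftUnitor (A) : Rw (leftUnitorInv A ⊚ leftUnitor A) (id _)
  | rightUnitor_inv (A) : Rw (rightUnitor A ⊚ rightUnitorInv A) (id _)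
  | inv_rightUnitor (A) : Rw (rightUnitorInv A ⊚ rightUnitor A) (id _)
  | assoc_nat {A B C A' B' C'} (f : Diag A A') (g : Diag B B') (h : Diag C C') :
      Rw (((f ⊠ g) ⊠ h) ⊚ assoc A' B' C') (assoc A B C ⊚ (f ⊠ (g ⊠ h)))
  | leftUnitor_nat {A B} (f : Diag A B) :
      Rw ((id .unit ⊠ f) ⊚ leftUnitor B) (leftUnitor A ⊚ f)
  | rightUnitor_nat {A B} (f : Diag A B) :
      Rw ((f ⊠ id .unit) ⊚ rightUnitor B) (rightUnitor A ⊚ f)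
  | pentagon (A B C D) :
      Rw ((assoc A B C ⊠ id D) ⊚ assoc A (B.tensor C) D ⊚ (id A ⊠ assoc B C D))
        (assoc (A.tensor B) C D ⊚ assoc A B (C.tensor D))
  | triangle (A B) : Rw (assoc A .unit B ⊚ (id A ⊠ leftUnitor B)) (rightUnitor A ⊠ id B)
  | swap_nat {A B A' B'} (f : Diag A A') (g : Diag B B') :
      Rw ((f ⊠ g) ⊚ swap A' B') (swap A B ⊚ (g ⊠ f))
  | swap_swap (A B) : Rw (swap A B ⊚ swap B A) (id _)
  | hexagon (A B C) :
      Rw (assoc A B C ⊚ swap A (B.tensor C) ⊚ assoc B C A)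
        ((swap A B ⊠ id C) ⊚ assoc B A C ⊚ (id B ⊠ swap A C))
  -- a composite system can be drawn as one wire or as several
  | infSplit_merge (X Y) : Rw (infSplit X Y ⊚ infMerge X Y) (id _)
  | infMerge_split (X Y) : Rw (infMerge X Y ⊚ infSplit X Y) (id _)
  | infUnit_inv : Rw (infUnit ⊚ infUnitInv) (id _)
  | inv_infUnit : Rw (infUnitInv ⊚ infUnit) (id _)
  | causSplit_merge (L M) : Rw (causSplit L M ⊚ causMerge L M) (id _)
  | causMerge_split (L M) : Rw (causMerge L M ⊚ causSplit L M) (id _)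
  | causUnit_inv : Rw (causUnit ⊚ causUnitInv) (id _)
  | inv_causUnit : Rw (causUnitInv ⊚ causUnit) (id _)
  -- the inclusion of substochastic maps is diagram-preserving
  | infer_id (X) : Rw (infer (SubStoch.id X)) (id _)
  | infer_comp {X Y Z} (S : SubStoch X Y) (T : SubStoch Y Z) :
      Rw (infer (S.comp T)) (infer S ⊚ infer T)
  | infer_tensor {X Y X' Y'} (S : SubStoch X Y) (T : SubStoch X' Y') :
      Rw (infer (S.tensor T)) (infSplit X X' ⊚ (infer S ⊠ infer T) ⊚ infMerge Y Y')
  | infer_swap (X Y : FinSpace) :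
      Rw (infer (SubStoch.swap X Y)) (infSplit X Y ⊚ swap _ _ ⊚ infMerge Y X)
  | infer_assoc (X Y Z : FinSpace) :
      Rw (infer (SubStoch.assoc X Y Z))
        (infSplit _ Z ⊚ (infSplit X Y ⊠ id _) ⊚ assoc _ _ _ ⊚ (id _ ⊠ infMerge Y Z) ⊚
          infMerge X _)
  | infer_leftUnitor (X : FinSpace) :
      Rw (infer (SubStoch.leftUnitor X))
        (infSplit star X ⊚ (infUnit ⊠ id _) ⊚ leftUnitor _)
  | infer_rightUnitor (X : FinSpace) :
      Rw (infer (SubStoch.rightUnitor X))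
        (infSplit X star ⊚ (id _ ⊠ infUnit) ⊚ rightUnitor _)
  -- knowledge about causal dynamics: sequential and parallel composition
  | know_seq (L M N) :
      Rw ((id (.inf (fn M N)) ⊠ know L M) ⊚ know M N)
        (assocInv _ _ _ ⊚ ((infMerge _ _ ⊚ infer (SubStoch.seqComp L M N)) ⊠ id _) ⊚ know L N)
  | know_par (L M L' M') :
      Rw (know L M ⊠ know L' M')
        (midSwap _ _ _ _ ⊚
          ((infMerge _ _ ⊚ infer (SubStoch.parComp L M L' M')) ⊠ causMerge L L') ⊚
          know (L.prod L') (M.prod M') ⊚ causSplit M M')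
  -- certain knowledge of a wiring is that wiring
  | embed_id (L : FinSpace) : Rw (embed (fun x : L => x)) (id _)
  | embed_swap (L M : FinSpace) :
      Rw (embed (L := L.prod M) (M := M.prod L) fun p => (p.2, p.1))
        (causSplit L M ⊚ swap _ _ ⊚ causMerge M L)
  | embed_assoc (L M N : FinSpace) :
      Rw (embed (L := (L.prod M).prod N) (M := L.prod (M.prod N)) fun p => (p.1.1, (p.1.2, p.2)))
        (causSplit _ N ⊚ (causSplit L M ⊠ id _) ⊚ assoc _ _ _ ⊚ (id _ ⊠ causMerge M N) ⊚
          causMerge L _)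
  | embed_leftUnitor (L : FinSpace) :
      Rw (embed (L := star.prod L) (M := L) fun p => p.2)
        (causSplit star L ⊚ (causUnit ⊠ id _) ⊚ leftUnitor _)
  | embed_rightUnitor (L : FinSpace) :
      Rw (embed (L := L.prod star) (M := L) fun p => p.1)
        (causSplit L star ⊚ (id _ ⊠ causUnit) ⊚ rightUnitor _)
  -- learning: the tautological question, repeated questions, composite systems
  | learn_discard (L) : Rw (learn L ⊚ (discard L ⊠ id _) ⊚ leftUnitor _) (id _)
  | learn_learn (L) :
      Rw (learn L ⊚ (id _ ⊠ learn L))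
        (learn L ⊚ ((infer (SubStoch.copy L) ⊚ infSplit L L) ⊠ id _) ⊚ assoc _ _ _)
  | learn_par (L M) :
      Rw (learn (L.prod M))
        (causSplit L M ⊚ (learn L ⊠ learn M) ⊚ midSwap _ _ _ _ ⊚ (infMerge L M ⊠ causMerge L M))
  -- ignoring: composite systems, the trivial system, ignorability
  | ignore_par (L M) :
      Rw (ignore (L.prod M)) (causSplit L M ⊚ (ignore L ⊠ ignore M) ⊚ leftUnitor .unit)
  | ignore_star : Rw (ignore star) causUnit
  | know_ignore (L M) :
      Rw (know L M ⊚ ignore M) ((discard (fn L M) ⊠ ignore L) ⊚ leftUnitor .unit)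
  -- learning the output of a function of which one has knowledge is the same as learning its
  -- input and computing the output
  | know_learn (L M) :
      Rw (know L M ⊚ learn M)
        (((infer (SubStoch.copy (fn L M)) ⊚ infSplit _ _) ⊠ learn L) ⊚ midSwap _ _ _ _ ⊚
          ((infMerge _ _ ⊚ infer (SubStoch.funcApp L M)) ⊠ know L M))

end Diag

/-! ### Process theories obtained from diagrams -/

/-- A congruence on diagrams that respects the rewrite rules. -/
structure DiagCongr where
  rel : ∀ {A B : Sys}, Diag A B → Diag A B → Prop
  equivalence : ∀ A B : Sys, Equivalence (rel (A := A) (B := B))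
  comp : ∀ {A B C : Sys} {f f' : Diag A B} {g g' : Diag B C},
    rel f f' → rel g g' → rel (f.comp g) (f'.comp g')
  tensor : ∀ {A B A' B' : Sys} {f f' : Diag A B} {g g' : Diag A' B'},
    rel f f' → rel g g' → rel (f.tensor g) (f'.tensor g')
  of_rw : ∀ {A B : Sys} {f g : Diag A B}, Diag.Rw f g → rel f g

/-- Diagrams modulo a congruence. -/
abbrev DiagCongr.setoid (R : DiagCongr) (A B : Sys) : Setoid (Diag A B) :=
  ⟨R.rel, R.equivalence A B⟩

/-- The process theory of diagrams modulo the congruence `R`, as a symmetric monoidal category. -/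
structure Theory (R : DiagCongr) : Type 1 where of ::
  /-- the underlying system -/
  sys : Sys

namespace Theory

variable {R : DiagCongr}

instance : Category.{1} (Theory R) where
  Hom A B := Quotient (R.setoid A.sys B.sys)
  id A := Quotient.mk _ (Diag.id A.sys)
  comp := Quotient.map₂ Diag.comp fun _ _ hf _ _ hg => R.comp hf hg
  id_comp := by rintro _ _ ⟨f⟩; exact Quotient.sound (R.of_rw (.id_comp f))
  comp_id := by rintro _ _ ⟨f⟩; exact Quotient.sound (R.of_rw (.comp_id f))
  assoc := by rintro _ _ _ _ ⟨f⟩ ⟨g⟩ ⟨h⟩; exact Quotient.sound (R.of_rw (.comp_assoc f g h))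

/-- The process represented by a diagram. -/
def proc (R : DiagCongr) {A B : Sys} (f : Diag A B) : (⟨A⟩ : Theory R) ⟶ ⟨B⟩ := Quotient.mk _ f

theorem proc_eq {A B : Sys} {f g : Diag A B} (h : Diag.Rw f g) : proc R f = proc R g :=
  Quotient.sound (R.of_rw h)

theorem proc_surj {A B : Sys} (f : (⟨A⟩ : Theory R) ⟶ ⟨B⟩) : ∃ d : Diag A B, proc R d = f :=
  Quotient.exists_rep f

instance : MonoidalCategoryStruct (Theory R) where
  tensorObj A B := ⟨A.sys.tensor B.sys⟩
  tensorUnit := ⟨.unit⟩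
  tensorHom := Quotient.map₂ Diag.tensor fun _ _ hf _ _ hg => R.tensor hf hg
  whiskerLeft A _ _ f := Quotient.map (Diag.tensor (Diag.id A.sys))
    (fun _ _ h => R.tensor ((R.equivalence _ _).refl _) h) f
  whiskerRight f A := Quotient.map (fun g => Diag.tensor g (Diag.id A.sys))
    (fun _ _ h => R.tensor h ((R.equivalence _ _).refl _)) f
  associator A B C := ⟨proc R (.assoc A.sys B.sys C.sys), proc R (.assocInv A.sys B.sys C.sys),
    proc_eq (.assoc_inv _ _ _), proc_eq (.inv_assoc _ _ _)⟩
  leftUnitor A := ⟨proc R (.leftUnitor A.sys), proc R (.leftUnitorInv A.sys),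
    proc_eq (.leftUnitor_inv _), proc_eq (.inv_leftUnitor _)⟩
  rightUnitor A := ⟨proc R (.rightUnitor A.sys), proc R (.rightUnitorInv A.sys),
    proc_eq (.rightUnitor_inv _), proc_eq (.inv_rightUnitor _)⟩

instance : MonoidalCategory (Theory R) := MonoidalCategory.ofTensorHom
  (id_tensorHom_id := fun _ _ => proc_eq (.tensor_id _ _))
  (id_tensorHom := by rintro _ _ _ ⟨f⟩; rfl)
  (tensorHom_id := by rintro _ _ ⟨f⟩ _; rfl)
  (tensorHom_comp_tensorHom := by
    rintro _ _ _ _ _ _ ⟨f⟩ ⟨f'⟩ ⟨g⟩ ⟨g'⟩; exact proc_eq (.tensor_comp f f' g g'))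
  (associator_naturality := by
    rintro _ _ _ _ _ _ ⟨f⟩ ⟨g⟩ ⟨h⟩; exact proc_eq (.assoc_nat f g h))
  (leftUnitor_naturality := by rintro _ _ ⟨f⟩; exact proc_eq (.leftUnitor_nat f))
  (rightUnitor_naturality := by rintro _ _ ⟨f⟩; exact proc_eq (.rightUnitor_nat f))
  (pentagon := fun _ _ _ _ => proc_eq (.pentagon _ _ _ _))
  (triangle := fun _ _ => proc_eq (.triangle _ _))

/-- The braiding is the crossing of two wires. -/
def crossing (A B : Theory R) : A ⊗ B ≅ B ⊗ A :=
  ⟨proc R (.swap A.sys B.sys), proc R (.swap B.sys A.sys), proc_eq (.swap_swap _ _),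
    proc_eq (.swap_swap _ _)⟩

theorem hexagon (A B C : Theory R) :
    (α_ A B C).hom ≫ (crossing A (B ⊗ C)).hom ≫ (α_ B C A).hom =
      ((crossing A B).hom ▷ C) ≫ (α_ B A C).hom ≫ (B ◁ (crossing A C).hom) :=
  proc_eq (.hexagon _ _ _)

instance : SymmetricCategory (Theory R) where
  braiding := crossing
  braiding_naturality_right := by
    rintro A _ _ ⟨f⟩; exact proc_eq (.swap_nat (.id A.sys) f)
  braiding_naturality_left := by
    rintro _ _ ⟨f⟩ A; exact proc_eq (.swap_nat f (.id A.sys))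
  hexagon_forward := hexagon
  hexagon_reverse A B C := by
    have h := congrArg Iso.inv (Iso.ext (hexagon C A B) :
      α_ C A B ≪≫ crossing C (A ⊗ B) ≪≫ α_ A B C =
        whiskerRightIso (crossing C A) B ≪≫ α_ A C B ≪≫ whiskerLeftIso A (crossing C B))
    simpa [crossing] using h
  symmetry _ _ := proc_eq (.swap_swap _ _)

/-! The generators, as processes of the theory. -/

/-- A substochastic map, as a process. -/
def infer {X Y : FinSpace} (S : SubStoch X Y) : (⟨.inf X⟩ : Theory R) ⟶ ⟨.inf Y⟩ :=
  proc R (.infer S)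
/-- The first generator. -/
def know (L M : FinSpace) : (⟨.inf (fn L M)⟩ : Theory R) ⊗ ⟨.caus L⟩ ⟶ ⟨.caus M⟩ :=
  proc R (.know L M)
/-- The second generator. -/
def learn (L : FinSpace) : (⟨.caus L⟩ : Theory R) ⟶ ⟨.inf L⟩ ⊗ ⟨.caus L⟩ := proc R (.learn L)

/-- A composite inferential system, as one wire or as two. -/
def infWires (X Y : FinSpace) : (⟨.inf (X.prod Y)⟩ : Theory R) ≅ ⟨.inf X⟩ ⊗ ⟨.inf Y⟩ :=
  ⟨proc R (.infSplit X Y), proc R (.infMerge X Y), proc_eq (.infSplit_merge _ _),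
    proc_eq (.infMerge_split _ _)⟩
/-- The trivial inferential system. -/
def infUnit : (⟨.inf star⟩ : Theory R) ≅ 𝟙_ (Theory R) :=
  ⟨proc R .infUnit, proc R .infUnitInv, proc_eq .infUnit_inv, proc_eq .inv_infUnit⟩
/-- A composite causal system, as one wire or as two. -/
def causWires (L M : FinSpace) : (⟨.caus (L.prod M)⟩ : Theory R) ≅ ⟨.caus L⟩ ⊗ ⟨.caus M⟩ :=
  ⟨proc R (.causSplit L M), proc R (.causMerge L M), proc_eq (.causSplit_merge _ _),
    proc_eq (.causMerge_split _ _)⟩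
/-- The trivial causal system. -/
def causUnit : (⟨.caus star⟩ : Theory R) ≅ 𝟙_ (Theory R) :=
  ⟨proc R .causUnit, proc R .causUnitInv, proc_eq .causUnit_inv, proc_eq .inv_causUnit⟩

theorem midSwap_midSwap (A B C D : Theory R) : tensorμ A B C D ≫ tensorμ A C B D = 𝟙 _ := by
  have h : A ◁ (β_ B C).hom ▷ D ≫ A ◁ (β_ C B).hom ▷ D = 𝟙 _ := by
    rw [← MonoidalCategory.whiskerLeft_comp, ← comp_whiskerRight, SymmetricCategory.symmetry]
    simp
  simp [tensorμ, reassoc_of% h]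

/-- The wiring that exchanges the two middle systems of four, as an isomorphism. -/
def midSwap (A B C D : Theory R) : (A ⊗ B) ⊗ (C ⊗ D) ≅ (A ⊗ C) ⊗ (B ⊗ D) where
  hom := tensorμ A B C D
  inv := tensorμ A C B D
  hom_inv_id := midSwap_midSwap A B C D
  inv_hom_id := midSwap_midSwap A C B D

/-- The wiring that gathers the inferential systems of `A` in one inferential wire and the causal
systems of `A` in one causal wire. -/
def gather : (A : Sys) → ((⟨A⟩ : Theory R) ≅ ⟨.inf A.infPart⟩ ⊗ ⟨.caus A.causPart⟩)
  | .unit => (λ_ (𝟙_ (Theory R))).symm ≪≫ (infUnit ⊗ᵢ causUnit).symm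
  | .inf _ => (ρ_ _).symm ≪≫ (Iso.refl _ ⊗ᵢ causUnit.symm)
  | .caus _ => (λ_ _).symm ≪≫ (infUnit.symm ⊗ᵢ Iso.refl _)
  | .tensor A B => (gather A ⊗ᵢ gather B) ≪≫ midSwap _ _ _ _ ≪≫
      ((infWires _ _).symm ⊗ᵢ (causWires _ _).symm)

/-- The normal form with one wire of each kind: the inferential input `X` is mapped by `S` to a
variable `Z` and to knowledge about the function from `L` to `M`; the causal input `L` is learned
and is then subjected to that function; the value of `Y` is obtained by applying `P` to `Z` and to
what was learned about `L`. -/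
def coreForm {X Y L M Z : FinSpace} (S : SubStoch X (Z.prod (fn L M)))
    (P : SubStoch (Z.prod L) Y) :
    (⟨.inf X⟩ : Theory R) ⊗ ⟨.caus L⟩ ⟶ ⟨.inf Y⟩ ⊗ ⟨.caus M⟩ :=
  ((infer S ≫ (infWires Z (fn L M)).hom) ⊗ₘ learn L) ≫ tensorμ _ _ _ _ ≫
    (((infWires Z L).inv ≫ infer P) ⊗ₘ know L M)

/-- The normal form from `A` to `B`, with stochastic map `S` and partial function `P`. -/
def normalForm {A B : Sys} {Z : FinSpace}
    (S : SubStoch A.infPart (Z.prod (fn A.causPart B.causPart)))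
    (P : Z × A.causPart → Option B.infPart) : (⟨A⟩ : Theory R) ⟶ ⟨B⟩ :=
  (gather A).hom ≫
    coreForm S (SubStoch.ofPartial (X := Z.prod A.causPart) P) ≫ (gather B).inv

end Theory

open Theory

/-! ### The classical realist theory, predictions and inferential equivalence -/

/-- The congruence generated by the rewrite rules alone. -/
def rwCongr : DiagCongr where
  rel := Diag.Rw
  equivalence _ _ := ⟨.refl, .symm, .trans⟩
  comp := .comp_congr
  tensor := .tensor_congr
  of_rw h := h

/-- The classical realist causal-inferential theory F-S. -/
abbrev FS := Theory rwCongr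

/-- A prediction map: a diagram-preserving map from the causally closed processes of F-S to
substochastic maps, which is a left inverse of the inclusion of substochastic maps. A composite
inferential system is sent to the product of its components. -/
structure PredictionMap where
  map : ∀ {A B : Sys}, A.IsInferential → B.IsInferential → ((⟨A⟩ : FS) ⟶ ⟨B⟩) →
    SubStoch A.infPart B.infPart
  map_id : ∀ {A : Sys} (hA : A.IsInferential), map hA hA (𝟙 _) = SubStoch.id _
  map_comp : ∀ {A B C : Sys} (hA : A.IsInferential) (hB : B.IsInferential)
    (hC : C.IsInferential) (f : (⟨A⟩ : FS) ⟶ ⟨B⟩) (g : (⟨B⟩ : FS) ⟶ ⟨C⟩),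
    map hA hC (f ≫ g) = (map hA hB f).comp (map hB hC g)
  map_tensor : ∀ {A B A' B' : Sys} (hA : A.IsInferential) (hB : B.IsInferential)
    (hA' : A'.IsInferential) (hB' : B'.IsInferential) (f : (⟨A⟩ : FS) ⟶ ⟨B⟩)
    (g : (⟨A'⟩ : FS) ⟶ ⟨B'⟩),
    map (A := A.tensor A') (B := B.tensor B') ⟨hA, hA'⟩ ⟨hB, hB'⟩ (f ⊗ₘ g) =
      (map hA hB f).tensor (map hA' hB' g)
  map_associator : ∀ {A B C : Sys} (hA : A.IsInferential) (hB : B.IsInferential)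
    (hC : C.IsInferential),
    map (A := (A.tensor B).tensor C) (B := A.tensor (B.tensor C)) ⟨⟨hA, hB⟩, hC⟩ ⟨hA, hB, hC⟩
      (α_ (⟨A⟩ : FS) ⟨B⟩ ⟨C⟩).hom = SubStoch.assoc _ _ _
  map_leftUnitor : ∀ {A : Sys} (hA : A.IsInferential),
    map (A := Sys.unit.tensor A) ⟨trivial, hA⟩ hA (λ_ (⟨A⟩ : FS)).hom =
      SubStoch.leftUnitor _
  map_rightUnitor : ∀ {A : Sys} (hA : A.IsInferential),
    map (A := A.tensor Sys.unit) ⟨hA, trivial⟩ hA (ρ_ (⟨A⟩ : FS)).hom =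
      SubStoch.rightUnitor _
  map_braiding : ∀ {A B : Sys} (hA : A.IsInferential) (hB : B.IsInferential),
    map (A := A.tensor B) (B := B.tensor A) ⟨hA, hB⟩ ⟨hB, hA⟩ (β_ (⟨A⟩ : FS) ⟨B⟩).hom =
      SubStoch.swap _ _
  map_infWires : ∀ X Y : FinSpace,
    map (A := .inf (X.prod Y)) (B := (Sys.inf X).tensor (.inf Y)) trivial ⟨trivial, trivial⟩
      (infWires X Y).hom = SubStoch.id _
  map_infUnit : map (A := .inf star) (B := .unit) trivial trivial infUnit.hom = SubStoch.id _
  map_infer : ∀ {X Y : FinSpace} (S : SubStoch X Y),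
    map (A := .inf X) (B := .inf Y) trivial trivial (infer S) = S

/-- Inferential equivalence: every tester, made of a process `x` before and a process `y` after,
which share an auxiliary system `W`, and such that the result is causally closed, leads to the same
prediction. -/
def InfEquiv (p : PredictionMap) {A B : Sys} (D E : (⟨A⟩ : FS) ⟶ ⟨B⟩) : Prop :=
  ∀ (U V W : Sys) (hU : U.IsInferential) (hV : V.IsInferential)
    (x : (⟨U⟩ : FS) ⟶ ⟨A⟩ ⊗ ⟨W⟩) (y : (⟨B⟩ : FS) ⊗ ⟨W⟩ ⟶ ⟨V⟩),
    p.map hU hV (x ≫ (D ▷ ⟨W⟩) ≫ y) = p.map hU hV (x ≫ (E ▷ ⟨W⟩) ≫ y)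

namespace InfEquiv

variable {p : PredictionMap}

theorem refl {A B : Sys} (D : (⟨A⟩ : FS) ⟶ ⟨B⟩) : InfEquiv p D D := fun _ _ _ _ _ _ _ => rfl

theorem symm {A B : Sys} {D E : (⟨A⟩ : FS) ⟶ ⟨B⟩} (h : InfEquiv p D E) : InfEquiv p E D :=
  fun U V W hU hV x y => (h U V W hU hV x y).symm

theorem trans {A B : Sys} {D E F : (⟨A⟩ : FS) ⟶ ⟨B⟩} (h : InfEquiv p D E)
    (h' : InfEquiv p E F) : InfEquiv p D F :=
  fun U V W hU hV x y => (h U V W hU hV x y).trans (h' U V W hU hV x y)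

/-- Inferential equivalence is preserved by clamps. -/
theorem clamp {A B A' B' : Sys} (W : Sys) {D E : (⟨A⟩ : FS) ⟶ ⟨B⟩} (h : InfEquiv p D E)
    (c : (⟨A'⟩ : FS) ⟶ ⟨A⟩ ⊗ ⟨W⟩) (d : (⟨B⟩ : FS) ⊗ ⟨W⟩ ⟶ ⟨B'⟩) :
    InfEquiv p (c ≫ (D ▷ ⟨W⟩) ≫ d) (c ≫ (E ▷ ⟨W⟩) ≫ d) := by
  intro U V Z hU hV x y
  have := h U V (W.tensor Z) hU hV (x ≫ c ▷ _ ≫ (α_ (⟨A⟩ : FS) ⟨W⟩ ⟨Z⟩).hom)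
    ((α_ (⟨B⟩ : FS) ⟨W⟩ ⟨Z⟩).inv ≫ d ▷ _ ≫ y)
  have key : ∀ F : (⟨A⟩ : FS) ⟶ ⟨B⟩, x ≫ (c ≫ (F ▷ ⟨W⟩) ≫ d) ▷ ⟨Z⟩ ≫ y =
      (x ≫ c ▷ _ ≫ (α_ (⟨A⟩ : FS) ⟨W⟩ ⟨Z⟩).hom) ≫ (F ▷ (⟨W.tensor Z⟩ : FS)) ≫
        ((α_ (⟨B⟩ : FS) ⟨W⟩ ⟨Z⟩).inv ≫ d ▷ _ ≫ y) := by
    intro F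
    change _ = (x ≫ c ▷ _ ≫ (α_ (⟨A⟩ : FS) ⟨W⟩ ⟨Z⟩).hom) ≫ (F ▷ ((⟨W⟩ : FS) ⊗ ⟨Z⟩)) ≫
        ((α_ (⟨B⟩ : FS) ⟨W⟩ ⟨Z⟩).inv ≫ d ▷ _ ≫ y)
    simp
  rw [key, key]
  exact this

theorem comp {A B C : Sys} {D D' : (⟨A⟩ : FS) ⟶ ⟨B⟩} {E E' : (⟨B⟩ : FS) ⟶ ⟨C⟩}
    (h : InfEquiv p D D') (h' : InfEquiv p E E') : InfEquiv p (D ≫ E) (D' ≫ E') := by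
  have h1 := h.clamp .unit (ρ_ (⟨A⟩ : FS)).inv ((ρ_ (⟨B⟩ : FS)).hom ≫ E)
  have h2 := h'.clamp .unit (D' ≫ (ρ_ (⟨B⟩ : FS)).inv) (ρ_ (⟨C⟩ : FS)).hom
  have k1 : ∀ F : (⟨A⟩ : FS) ⟶ ⟨B⟩, (ρ_ (⟨A⟩ : FS)).inv ≫ (F ▷ (⟨.unit⟩ : FS)) ≫
      (ρ_ (⟨B⟩ : FS)).hom ≫ E = F ≫ E := fun F => by
    change (ρ_ (⟨A⟩ : FS)).inv ≫ (F ▷ 𝟙_ FS) ≫ (ρ_ (⟨B⟩ : FS)).hom ≫ E = F ≫ E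
    simp
  have k2 : ∀ F : (⟨B⟩ : FS) ⟶ ⟨C⟩, (D' ≫ (ρ_ (⟨B⟩ : FS)).inv) ≫ (F ▷ (⟨.unit⟩ : FS)) ≫
      (ρ_ (⟨C⟩ : FS)).hom = D' ≫ F := fun F => by
    change (D' ≫ (ρ_ (⟨B⟩ : FS)).inv) ≫ (F ▷ 𝟙_ FS) ≫ (ρ_ (⟨C⟩ : FS)).hom = D' ≫ F
    simp
  rw [k1, k1] at h1
  rw [k2, k2] at h2
  exact h1.trans h2

theorem tensor {A B A' B' : Sys} {D D' : (⟨A⟩ : FS) ⟶ ⟨B⟩} {E E' : (⟨A'⟩ : FS) ⟶ ⟨B'⟩}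
    (h : InfEquiv p D D') (h' : InfEquiv p E E') :
    InfEquiv p (A := A.tensor A') (B := B.tensor B') (D ⊗ₘ E) (D' ⊗ₘ E') := by
  have h1 := h.clamp (A' := A.tensor A') (B' := B.tensor B') A' (𝟙 _) ((⟨B⟩ : FS) ◁ E)
  have h2 := h'.clamp (A' := A.tensor A') (B' := B.tensor B') B
    (D' ▷ ⟨A'⟩ ≫ (β_ (⟨B⟩ : FS) ⟨A'⟩).hom) (β_ (⟨B'⟩ : FS) ⟨B⟩).hom
  have k1 : ∀ F : (⟨A⟩ : FS) ⟶ ⟨B⟩,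
      𝟙 ((⟨A⟩ : FS) ⊗ ⟨A'⟩) ≫ (F ▷ ⟨A'⟩) ≫ ((⟨B⟩ : FS) ◁ E) = F ⊗ₘ E := fun F => by
    simp [MonoidalCategory.tensorHom_def]
  have k2 : ∀ F : (⟨A'⟩ : FS) ⟶ ⟨B'⟩, (D' ▷ ⟨A'⟩ ≫ (β_ (⟨B⟩ : FS) ⟨A'⟩).hom) ≫ (F ▷ ⟨B⟩) ≫
      (β_ (⟨B'⟩ : FS) ⟨B⟩).hom = D' ⊗ₘ F := fun F => by
    simp [MonoidalCategory.tensorHom_def]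
  exact (k1 D ▸ k1 D' ▸ h1).trans (k2 E ▸ k2 E' ▸ h2)

end InfEquiv

/-- Inferential equivalence as a congruence on diagrams. -/
def infCongr (p : PredictionMap) : DiagCongr where
  rel D E := InfEquiv p (proc rwCongr D) (proc rwCongr E)
  equivalence _ _ := ⟨fun _ => .refl _, .symm, .trans⟩
  comp h h' := h.comp h'
  tensor h h' := h.tensor h'
  of_rw h := by rw [proc_eq h]; exact .refl _

/-- The quotiented classical realist theory: F-S modulo inferential equivalence. -/
abbrev QuotientFS (p : PredictionMap) := Theory (infCongr p)

/-! ### Prediction maps exist -/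

namespace SubStoch

/-- The weighted sum of a function of the output. -/
def ev {X Y : FinSpace} (S : SubStoch X Y) (x : X) (φ : Y → ℝ≥0) : ℝ≥0 := ∑ y, S.val x y * φ y

theorem ev_ext {X Y : FinSpace} {S T : SubStoch X Y} (h : ∀ x φ, S.ev x φ = T.ev x φ) :
    S = T := by
  ext x y
  simpa [ev] using congrArg NNReal.toReal (h x fun z => if z = y then 1 else 0)

theorem ev_det {X Y : FinSpace} (f : X → Y) (x : X) (φ : Y → ℝ≥0) :
    (det f).ev x φ = φ (f x) := by
  simp [ev, det]

theorem ev_comp {X Y Z : FinSpace} (S : SubStoch X Y) (T : SubStoch Y Z) (x : X) (φ : Z → ℝ≥0) :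
    (S.comp T).ev x φ = S.ev x fun y => T.ev y φ := by
  simp only [ev, comp, Finset.sum_mul, Finset.mul_sum, mul_assoc]
  exact Finset.sum_comm

theorem ev_tensor {X Y X' Y' : FinSpace} (S : SubStoch X Y) (T : SubStoch X' Y')
    (x : X.prod X') (φ : Y.prod Y' → ℝ≥0) :
    (S.tensor T).ev x φ = S.ev x.1 fun y => T.ev x.2 fun y' => φ (y, y') := by
  simp only [ev, tensor, Finset.mul_sum, ← mul_assoc]
  exact Fintype.sum_prod_type (α₁ := Y) (α₂ := Y') _

theorem ev_swap {X Y X' Y' : FinSpace} (S : SubStoch X Y) (T : SubStoch X' Y') (x : X) (x' : X')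
    (φ : Y → Y' → ℝ≥0) :
    (S.ev x fun y => T.ev x' fun y' => φ y y') = T.ev x' fun y' => S.ev x fun y => φ y y' := by
  simp only [ev, Finset.mul_sum]
  rw [Finset.sum_comm]
  exact Finset.sum_congr rfl fun _ _ => Finset.sum_congr rfl fun _ _ => mul_left_comm _ _ _

end SubStoch

/-- The product of all the systems in `A`. -/
def Sys.space : Sys → FinSpace
  | unit => star
  | inf X => X
  | caus L => L
  | tensor A B => (space A).prod (space B)

/-- The matrix obtained from a diagram by reading causal wires as inferential ones. -/
def Diag.sem : ∀ {A B : Sys}, Diag A B → SubStoch A.space B.space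
  | _, _, .id A => SubStoch.id A.space
  | _, _, .comp f g => (sem f).comp (sem g)
  | _, _, .tensor f g => (sem f).tensor (sem g)
  | _, _, .assoc _ _ _ => SubStoch.assoc _ _ _
  | _, _, .assocInv A B C =>
    SubStoch.det (X := A.space.prod (B.space.prod C.space))
      (Y := (A.space.prod B.space).prod C.space) fun p => ((p.1, p.2.1), p.2.2)
  | _, _, .leftUnitor _ => SubStoch.leftUnitor _
  | _, _, .leftUnitorInv A =>
    SubStoch.det (X := A.space) (Y := star.prod A.space) fun x => (PUnit.unit, x)
  | _, _, .rightUnitor _ => SubStoch.rightUnitor _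
  | _, _, .rightUnitorInv A =>
    SubStoch.det (X := A.space) (Y := A.space.prod star) fun x => (x, PUnit.unit)
  | _, _, .swap _ _ => SubStoch.swap _ _
  | _, _, .infSplit X Y => SubStoch.id (X.prod Y)
  | _, _, .infMerge X Y => SubStoch.id (X.prod Y)
  | _, _, .infUnit => SubStoch.id star
  | _, _, .infUnitInv => SubStoch.id star
  | _, _, .causSplit X Y => SubStoch.id (X.prod Y)
  | _, _, .causMerge X Y => SubStoch.id (X.prod Y)
  | _, _, .causUnit => SubStoch.id star
  | _, _, .causUnitInv => SubStoch.id star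
  | _, _, .infer S => S
  | _, _, .know L M => SubStoch.funcApp L M
  | _, _, .learn L => SubStoch.copy L
  | _, _, .ignore L => SubStoch.discard L

/-- The weighted sum of a function of the output, computed along the diagram. -/
def Diag.ev : ∀ {A B : Sys}, Diag A B → A.space → (B.space → ℝ≥0) → ℝ≥0
  | _, _, .id _, x, φ => φ x
  | _, _, .comp f g, x, φ => ev f x fun y => ev g y φ
  | _, _, .tensor f g, x, φ => ev f x.1 fun y => ev g x.2 fun y' => φ (y, y')
  | _, _, .assoc _ _ _, x, φ => φ (x.1.1, (x.1.2, x.2))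
  | _, _, .assocInv _ _ _, x, φ => φ ((x.1, x.2.1), x.2.2)
  | _, _, .leftUnitor _, x, φ => φ x.2
  | _, _, .leftUnitorInv _, x, φ => φ (PUnit.unit, x)
  | _, _, .rightUnitor _, x, φ => φ x.1
  | _, _, .rightUnitorInv _, x, φ => φ (x, PUnit.unit)
  | _, _, .swap _ _, x, φ => φ (x.2, x.1)
  | _, _, .infSplit _ _, x, φ => φ x
  | _, _, .infMerge _ _, x, φ => φ x
  | _, _, .infUnit, x, φ => φ x
  | _, _, .infUnitInv, x, φ => φ x
  | _, _, .causSplit _ _, x, φ => φ x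
  | _, _, .causMerge _ _, x, φ => φ x
  | _, _, .causUnit, x, φ => φ x
  | _, _, .causUnitInv, x, φ => φ x
  | _, _, .infer S, x, φ => S.ev x φ
  | _, _, .know _ _, x, φ => φ (x.1 x.2)
  | _, _, .learn _, x, φ => φ (x, x)
  | _, _, .ignore _, _, φ => φ PUnit.unit

theorem Diag.sem_ev {A B : Sys} (f : Diag A B) : ∀ x φ, f.sem.ev x φ = f.ev x φ := by
  induction f with
  | comp f g hf hg =>
    intro x φ
    refine (SubStoch.ev_comp _ _ x φ).trans ((hf _ _).trans ?_)
    exact congrArg (f.ev x) (funext fun y => hg y φ)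
  | tensor f g hf hg =>
    intro x φ
    refine (SubStoch.ev_tensor _ _ x φ).trans ((hf _ _).trans ?_)
    exact congrArg (f.ev x.1) (funext fun y => hg x.2 _)
  | infer => exact fun _ _ => rfl
  | _ => exact fun x φ => SubStoch.ev_det _ x φ

theorem Diag.ev_eq {A B : Sys} {f g : Diag A B} (h : Diag.Rw f g) : f.ev = g.ev := by
  induction h with
  | refl => rfl
  | symm _ ih => exact ih.symm
  | trans _ _ ih ih' => exact ih.trans ih'
  | comp_congr _ _ ih ih' => funext x φ; simp only [ev, ih, ih']
  | tensor_congr _ _ ih ih' => funext x φ; simp only [ev, ih, ih']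
  | tensor_comp f f' g g' =>
    funext x φ
    refine congrArg (f.ev x.1) (funext fun y => ?_)
    simp only [ev, ← sem_ev]
    exact (SubStoch.ev_swap _ _ _ _ _).symm
  | swap_nat f g =>
    funext x φ
    simp only [ev, ← sem_ev]
    exact SubStoch.ev_swap _ _ _ _ _
  | infer_id X => exact funext fun x => funext fun φ => SubStoch.ev_det _ x φ
  | infer_comp S T => exact funext fun x => funext fun φ => SubStoch.ev_comp S T x φ
  | infer_tensor S T => exact funext fun x => funext fun φ => SubStoch.ev_tensor S T x φ
  | infer_swap => exact funext fun x => funext fun φ => SubStoch.ev_det _ x φ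
  | infer_assoc => exact funext fun x => funext fun φ => SubStoch.ev_det _ x φ
  | infer_leftUnitor => exact funext fun x => funext fun φ => SubStoch.ev_det _ x φ
  | infer_rightUnitor => exact funext fun x => funext fun φ => SubStoch.ev_det _ x φ
  | embed_id | embed_swap | embed_assoc | embed_leftUnitor | embed_rightUnitor =>
    exact funext fun x => funext fun φ => SubStoch.ev_det _ _ _
  | know_seq | know_par | learn_discard | learn_learn | know_ignore =>
    funext x φ
    simp only [ev, Diag.discard, Diag.midSwap, SubStoch.seqComp, SubStoch.parComp, SubStoch.copy,
      SubStoch.discard]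
    first | exact SubStoch.ev_det _ _ _ | (symm; exact SubStoch.ev_det _ _ _)
  | know_learn =>
    exact funext fun x => funext fun φ =>
      ((SubStoch.ev_det _ _ _).trans (SubStoch.ev_det _ _ _)).symm
  | _ => rfl

theorem Diag.sem_eq {A B : Sys} {f g : Diag A B} (h : Diag.Rw f g) : f.sem = g.sem :=
  SubStoch.ev_ext fun x φ => by rw [sem_ev, sem_ev, ev_eq h]

theorem Sys.space_eq : ∀ {A : Sys}, A.IsInferential → A.space = A.infPart
  | .unit, _ => rfl
  | .inf _, _ => rfl
  | .tensor _ _, h => congrArg₂ FinSpace.prod (space_eq h.1) (space_eq h.2)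

/-- Change of the type labels along equalities. -/
def SubStoch.cast {X X' Y Y' : FinSpace} (hX : X = X') (hY : Y = Y') (S : SubStoch X Y) :
    SubStoch X' Y' := hX ▸ hY ▸ S

namespace SubStoch

variable {X Y Z X' Y' Z' : FinSpace}

theorem cast_comp (hX : X = X') (hY : Y = Y') (hZ : Z = Z') (S : SubStoch X Y)
    (T : SubStoch Y Z) : (S.comp T).cast hX hZ = (S.cast hX hY).comp (T.cast hY hZ) := by
  subst hX hY hZ; rfl

theorem cast_tensor {W W' : FinSpace} (hX : X = X') (hY : Y = Y') (hZ : Z = Z') (hW : W = W')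
    (S : SubStoch X Y) (T : SubStoch Z W) :
    (S.tensor T).cast (congrArg₂ FinSpace.prod hX hZ) (congrArg₂ FinSpace.prod hY hW) =
      (S.cast hX hY).tensor (T.cast hZ hW) := by
  subst hX hY hZ hW; rfl

theorem cast_id (hX : X = X') : (SubStoch.id X).cast hX hX = SubStoch.id X' := by
  subst hX; rfl

theorem cast_assoc (hX : X = X') (hY : Y = Y') (hZ : Z = Z') :
    (SubStoch.assoc X Y Z).cast (congrArg₂ FinSpace.prod (congrArg₂ FinSpace.prod hX hY) hZ)
      (congrArg₂ FinSpace.prod hX (congrArg₂ FinSpace.prod hY hZ)) = SubStoch.assoc X' Y' Z' := by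
  subst hX hY hZ; rfl

theorem cast_leftUnitor (hX : X = X') : (SubStoch.leftUnitor X).cast
    (congrArg (FinSpace.prod star) hX) hX = SubStoch.leftUnitor X' := by
  subst hX; rfl

theorem cast_rightUnitor (hX : X = X') : (SubStoch.rightUnitor X).cast
    (congrArg (fun W => W.prod star) hX) hX = SubStoch.rightUnitor X' := by
  subst hX; rfl

theorem cast_swap (hX : X = X') (hY : Y = Y') : (SubStoch.swap X Y).cast
    (congrArg₂ FinSpace.prod hX hY) (congrArg₂ FinSpace.prod hY hX) = SubStoch.swap X' Y' := by
  subst hX hY; rfl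

end SubStoch

/-- Prediction maps exist. -/
theorem PredictionMap.nonempty : Nonempty PredictionMap := ⟨{
  map := fun hA hB f => SubStoch.cast (Sys.space_eq hA) (Sys.space_eq hB)
    (Quotient.lift Diag.sem (fun _ _ h => Diag.sem_eq h) f)
  map_id := fun hA => SubStoch.cast_id (Sys.space_eq hA)
  map_comp := by rintro _ _ _ _ _ _ ⟨f⟩ ⟨g⟩; exact SubStoch.cast_comp _ _ _ f.sem g.sem
  map_tensor := by
    rintro _ _ _ _ _ _ _ _ ⟨f⟩ ⟨g⟩
    exact SubStoch.cast_tensor _ _ _ _ f.sem g.sem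
  map_associator := fun hA hB hC =>
    SubStoch.cast_assoc (Sys.space_eq hA) (Sys.space_eq hB) (Sys.space_eq hC)
  map_leftUnitor := fun hA => SubStoch.cast_leftUnitor (Sys.space_eq hA)
  map_rightUnitor := fun hA => SubStoch.cast_rightUnitor (Sys.space_eq hA)
  map_braiding := fun hA hB => SubStoch.cast_swap (Sys.space_eq hA) (Sys.space_eq hB)
  map_infWires := fun _ _ => rfl
  map_infUnit := rfl
  map_infer := fun _ => rfl }⟩

end CausalInf

open CausalInf

/-! Reading every causal wire as an inferential one gives each process a substochastic matrix,
`sem`. Two facts about it prove the theorem. Processes with equal matrices are inferentially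
equivalent (`InfEquiv.of_sem_eq`). Let `observeAll` learn every causal system and then ignore it.
The rules for the generators let an observation of the outputs be traded for an observation of the
inputs followed by a computation, and by induction on diagrams that computation is the matrix
(`proc_observeAll`). On an inferential system `observeAll` is invertible, so causally closed
processes with equal matrices are already equal in `FS`. No tester separates the two processes,
whatever the prediction map. Every matrix `T` from `X × L` to `Y × M` is the matrix of a normal form
(`exists_coreForm`). Given `x`, sample independently for each `l` a pair in `Option Y × M` from `T`
at `(x, l)`, the missing mass going to the outcome `none`. The outcomes form a function `L → Option
Y`, which is the value of `Z`; the states form the function `L → M` supplied to `know`. The causal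
input evaluates both at one and the same point `l₀`, so only the marginal at `l₀` matters, and the
propositional map, undefined on `none`, restores the missing mass. Correlations between `y` and `m`
survive because they are sampled jointly. -/

namespace CausalInf

open FinSpace Theory

namespace Theory

variable {R : DiagCongr}

/-! ### The rewrite rules as equations between processes, and the matrix of a process -/

/-- The third generator. -/
def ignore (L : FinSpace) : (⟨.caus L⟩ : Theory R) ⟶ 𝟙_ (Theory R) := proc R (.ignore L)

theorem infer_id (X : FinSpace) : infer (R := R) (SubStoch.id X) = 𝟙 _ := proc_eq (.infer_id X)

theorem infer_comp {X Y Z : FinSpace} (S : SubStoch X Y) (T : SubStoch Y Z) :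
    infer (R := R) (S.comp T) = infer S ≫ infer T := proc_eq (.infer_comp S T)

theorem infer_tensor {X Y X' Y' : FinSpace} (S : SubStoch X Y) (T : SubStoch X' Y') :
    infer (R := R) (S.tensor T) =
      (infWires X X').hom ≫ (infer S ⊗ₘ infer T) ≫ (infWires Y Y').inv :=
  proc_eq (.infer_tensor S T)

theorem infer_swap (X Y : FinSpace) : infer (R := R) (SubStoch.swap X Y) =
    (infWires X Y).hom ≫ (β_ _ _).hom ≫ (infWires Y X).inv := proc_eq (.infer_swap X Y)

theorem infer_assoc (X Y Z : FinSpace) : infer (R := R) (SubStoch.assoc X Y Z) =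
    (infWires _ Z).hom ≫ ((infWires X Y).hom ⊗ₘ 𝟙 _) ≫ (α_ _ _ _).hom ≫
      (𝟙 _ ⊗ₘ (infWires Y Z).inv) ≫ (infWires X _).inv := proc_eq (.infer_assoc X Y Z)

theorem infer_leftUnitor (X : FinSpace) : infer (R := R) (SubStoch.leftUnitor X) =
    (infWires star X).hom ≫ (infUnit.hom ⊗ₘ 𝟙 _) ≫ (λ_ _).hom := proc_eq (.infer_leftUnitor X)

theorem infer_rightUnitor (X : FinSpace) : infer (R := R) (SubStoch.rightUnitor X) =
    (infWires X star).hom ≫ (𝟙 _ ⊗ₘ infUnit.hom) ≫ (ρ_ _).hom := proc_eq (.infer_rightUnitor X)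

theorem learn_discard (L : FinSpace) : learn (R := R) L ≫
    ((infer (SubStoch.discard L) ≫ infUnit.hom) ⊗ₘ 𝟙 _) ≫ (λ_ _).hom = 𝟙 _ :=
  proc_eq (.learn_discard L)

theorem learn_learn (L : FinSpace) : learn (R := R) L ≫ (𝟙 _ ⊗ₘ learn L) =
    learn L ≫ ((infer (SubStoch.copy L) ≫ (infWires L L).hom) ⊗ₘ 𝟙 _) ≫ (α_ _ _ _).hom :=
  proc_eq (.learn_learn L)

theorem learn_prod (L M : FinSpace) : learn (R := R) (L.prod M) =
    (causWires L M).hom ≫ (learn L ⊗ₘ learn M) ≫ tensorμ _ _ _ _ ≫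
      ((infWires L M).inv ⊗ₘ (causWires L M).inv) :=
  proc_eq (.learn_par L M)

theorem ignore_prod (L M : FinSpace) : ignore (R := R) (L.prod M) =
    (causWires L M).hom ≫ (ignore L ⊗ₘ ignore M) ≫ (λ_ _).hom := proc_eq (.ignore_par L M)

theorem ignore_star : ignore (R := R) star = causUnit.hom := proc_eq .ignore_star

theorem know_ignore (L M : FinSpace) : know (R := R) L M ≫ ignore M =
    ((infer (SubStoch.discard _) ≫ infUnit.hom) ⊗ₘ ignore L) ≫ (λ_ _).hom :=
  proc_eq (.know_ignore L M)

theorem know_learn (L M : FinSpace) : know (R := R) L M ≫ learn M =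
    ((infer (SubStoch.copy _) ≫ (infWires _ _).hom) ⊗ₘ learn L) ≫ tensorμ _ _ _ _ ≫
      (((infWires _ _).inv ≫ infer (SubStoch.funcApp L M)) ⊗ₘ know L M) :=
  proc_eq (.know_learn L M)

/-- The matrix of a process of `FS` when causal wires are read as inferential ones. -/
def sem {A B : FS} (f : A ⟶ B) : SubStoch A.sys.space B.sys.space :=
  Quotient.lift Diag.sem (fun _ _ h => Diag.sem_eq h) f

theorem sem_comp {A B C : FS} (f : A ⟶ B) (g : B ⟶ C) : sem (f ≫ g) = (sem f).comp (sem g) := by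
  obtain ⟨f, rfl⟩ := proc_surj f
  obtain ⟨g, rfl⟩ := proc_surj g
  rfl

theorem sem_whiskerRight {A B : FS} (f : A ⟶ B) (C : FS) :
    sem (f ▷ C) = (sem f).tensor (SubStoch.id C.sys.space) := by
  obtain ⟨f, rfl⟩ := proc_surj f
  rfl

/-! ### Observation of causal systems -/

/-- Learn about a causal system, which is then ignored. -/
def observe (L : FinSpace) : (⟨.caus L⟩ : Theory R) ⟶ ⟨.inf L⟩ :=
  learn L ≫ (𝟙 _ ⊗ₘ ignore L) ≫ (ρ_ _).hom

/-- Learn about all the causal systems in `A`, which are then ignored. -/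
def observeAll : (A : Sys) → ((⟨A⟩ : Theory R) ⟶ ⟨.inf A.space⟩)
  | .unit => infUnit.inv
  | .inf _ => 𝟙 _
  | .caus L => observe L
  | .tensor A B => (observeAll A ⊗ₘ observeAll B) ≫ (infWires _ _).inv

/-- Without causal systems nothing is learned or ignored: `observeAll` only merges the inferential
wires into one. This is what makes matrices faithful on causally closed processes. -/
theorem isIso_observeAll : ∀ {A : Sys}, A.IsInferential → IsIso (observeAll (R := R) A)
  | .unit, _ => inferInstanceAs (IsIso infUnit.inv)
  | .inf _, _ => inferInstanceAs (IsIso (𝟙 _))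
  | .tensor A B, h => by
    have := isIso_observeAll h.1
    have := isIso_observeAll h.2
    exact inferInstanceAs
      (IsIso ((observeAll (R := R) A ⊗ₘ observeAll B) ≫ (infWires _ _).inv))

theorem copy_discard (X : FinSpace) : infer (R := R) (SubStoch.copy X) ≫ (infWires X X).hom ≫
    (𝟙 _ ⊗ₘ (infer (SubStoch.discard X) ≫ infUnit.hom)) ≫ (ρ_ _).hom = 𝟙 _ := by
  have h : (SubStoch.copy X).comp (((SubStoch.id X).tensor (SubStoch.discard X)).comp
      (SubStoch.rightUnitor X)) = SubStoch.id X := by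
    refine SubStoch.ev_ext fun x φ => ?_
    refine (SubStoch.ev_comp _ _ _ _).trans ((SubStoch.ev_det _ _ _).trans ?_)
    refine (SubStoch.ev_comp _ _ _ _).trans ((SubStoch.ev_tensor _ _ _ _).trans ?_)
    exact (SubStoch.ev_det _ _ _).trans ((SubStoch.ev_det _ _ _).trans
      ((SubStoch.ev_det _ _ _).trans (SubStoch.ev_det (fun y : X => y) x φ).symm))
  refine Eq.trans ?_ ((congrArg infer h).trans (infer_id X))
  simp only [infer_comp, infer_tensor, infer_rightUnitor, infer_id, Category.assoc,
    Iso.inv_hom_id_assoc, MonoidalCategory.tensorHom_comp_tensorHom_assoc, Category.comp_id]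

/-- Once two causal wires have been ignored, the crossing that separated them from the inferential
wires moves only units, and disappears. -/
theorem tensorμ_unit {C : Type*} [Category* C] [MonoidalCategory C] [BraidedCategory C]
    {X Y T : C} (t : X ⊗ Y ⟶ T) :
    tensorμ X (𝟙_ C) Y (𝟙_ C) ≫ (t ⊗ₘ (λ_ (𝟙_ C)).hom) ≫ (ρ_ T).hom =
      ((ρ_ X).hom ⊗ₘ (ρ_ Y).hom) ≫ t := by
  rw [rightUnitor_monoidal, MonoidalCategory.tensorHom_def', Category.assoc, Category.assoc,
    Category.assoc, rightUnitor_naturality]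

/-- By `know_learn`, one copy of the function computes the answer and the other drives the dynamics.
Ignoring the causal output discards the second copy and ignores the causal input, by `know_ignore`;
a copy of which one half is discarded is the identity. -/
theorem know_observe (L M : FinSpace) : know (R := R) L M ≫ observe M =
    (𝟙 _ ⊗ₘ observe L) ≫ (infWires _ _).inv ≫ infer (SubStoch.funcApp L M) := by
  have h : know (R := R) L M ≫ learn M ≫ (𝟙 _ ⊗ₘ ignore M) =
    ((infer (SubStoch.copy _) ≫ (infWires _ _).hom) ⊗ₘ learn L) ≫ tensorμ _ _ _ _ ≫
      (((infWires _ _).inv ≫ infer (SubStoch.funcApp L M)) ⊗ₘ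
        (((infer (SubStoch.discard _) ≫ infUnit.hom) ⊗ₘ ignore L) ≫ (λ_ _).hom)) := by
    rw [← Category.assoc, know_learn]
    simp only [Category.assoc, MonoidalCategory.tensorHom_comp_tensorHom, Category.comp_id,
      know_ignore]
  -- The discarding and ignoring effects are split off as a separate layer, so that naturality of
  -- `tensorμ` can move them in front of the crossing.
  have e : (((infWires _ _).inv ≫ infer (R := R) (SubStoch.funcApp L M)) ⊗ₘ
        (((infer (SubStoch.discard (fn L M)) ≫ infUnit.hom) ⊗ₘ ignore L) ≫ (λ_ _).hom)) =
      ((𝟙 _ ⊗ₘ 𝟙 _) ⊗ₘ ((infer (SubStoch.discard _) ≫ infUnit.hom) ⊗ₘ ignore L)) ≫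
        (((infWires _ _).inv ≫ infer (SubStoch.funcApp L M)) ⊗ₘ (λ_ _).hom) := by
    rw [tensorHom_comp_tensorHom, id_tensorHom_id, Category.id_comp]
  rw [observe, reassoc_of% h, e, Category.assoc, ← tensorμ_natural_assoc,
    tensorHom_comp_tensorHom_assoc, tensorμ_unit, tensorHom_comp_tensorHom_assoc]
  simp only [Category.assoc, copy_discard, observe]

/-- Learning a second time only copies the first answer, and ignoring the causal wire commutes with
that copy. -/
theorem learn_observe (L : FinSpace) : learn (R := R) L ≫ (𝟙 _ ⊗ₘ observe L) =
    observe L ≫ infer (SubStoch.copy L) ≫ (infWires L L).hom := by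
  -- With the generators replaced by variables, the claim is pure monoidal coherence plus the one
  -- rule `h`.
  have key : ∀ {I K : Theory R} (l : K ⟶ I ⊗ K) (g : K ⟶ 𝟙_ _) (c : I ⟶ I ⊗ I),
      l ≫ (𝟙 I ⊗ₘ l) = l ≫ (c ⊗ₘ 𝟙 K) ≫ (α_ _ _ _).hom →
      l ≫ (𝟙 I ⊗ₘ (l ≫ (𝟙 I ⊗ₘ g) ≫ (ρ_ I).hom)) = (l ≫ (𝟙 I ⊗ₘ g) ≫ (ρ_ I).hom) ≫ c := by
    intro I K l g c h
    simp only [id_tensorHom, tensorHom_id] at h ⊢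
    rw [MonoidalCategory.whiskerLeft_comp, reassoc_of% h]
    rw [Category.assoc, Category.assoc, ← rightUnitor_naturality, whisker_exchange_assoc]
    simp
  exact (key _ _ _ (learn_learn L)).trans (by rw [observe])

/-- The two effects act on different wires, so the answer may be marginalized before the causal
system is ignored; learning is then undone by `learn_discard`. -/
theorem observe_discard (L : FinSpace) :
    observe (R := R) L ≫ infer (SubStoch.discard L) ≫ infUnit.hom = ignore L := by
  have key : ∀ {I K : Theory R} (l : K ⟶ I ⊗ K) (g : K ⟶ 𝟙_ _) (d : I ⟶ 𝟙_ _),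
      l ≫ (d ⊗ₘ 𝟙 K) ≫ (λ_ K).hom = 𝟙 K → (l ≫ (𝟙 I ⊗ₘ g) ≫ (ρ_ I).hom) ≫ d = g := by
    intro I K l g d h
    have h' := h =≫ g
    simp only [id_tensorHom, tensorHom_id, Category.assoc, Category.id_comp] at h' ⊢
    refine Eq.trans ?_ h'
    rw [← leftUnitor_naturality, ← whisker_exchange_assoc, ← rightUnitor_naturality,
      unitors_equal]
  exact key _ _ _ (learn_discard L)

theorem observe_star : observe (R := R) star = causUnit.hom ≫ infUnit.inv := by
  rw [← ignore_star, ← observe_discard]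
  -- On a singleton, marginalization and the identity agree definitionally.
  have : infer (R := R) (SubStoch.discard star) = 𝟙 _ := infer_id star
  simp [this]

theorem observe_prod (L M : FinSpace) : observe (R := R) (L.prod M) =
    (causWires L M).hom ≫ (observe L ⊗ₘ observe M) ≫ (infWires L M).inv := by
  rw [observe, learn_prod, ignore_prod]
  simp only [Category.assoc, tensorHom_comp_tensorHom_assoc, Category.comp_id,
    Iso.inv_hom_id_assoc]
  have e : (infWires L M).inv ⊗ₘ ((ignore (R := R) L ⊗ₘ ignore M) ≫ (λ_ _).hom) =
      ((𝟙 _ ⊗ₘ 𝟙 _) ⊗ₘ (ignore L ⊗ₘ ignore M)) ≫ ((infWires L M).inv ⊗ₘ (λ_ _).hom) := by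
    rw [tensorHom_comp_tensorHom, id_tensorHom_id, Category.id_comp]
  rw [e, Category.assoc, ← tensorμ_natural_assoc, tensorμ_unit]
  simp only [tensorHom_comp_tensorHom_assoc, observe]

/-! ### Observation turns diagrams into matrices -/

theorem observeAll_tensor {R : DiagCongr} (A B : Sys) : observeAll (R := R) (A.tensor B) =
    (observeAll A ⊗ₘ observeAll B) ≫ (infWires _ _).inv := rfl

/-- Used to derive the case of each inverse wiring in `proc_observeAll` from that of the wiring
itself. -/
theorem comp_inv_eq_of_hom_comp {C : Type*} [Category* C] {A B A' B' : C} {i : A ≅ B}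
    {a : A ⟶ A'} {b : B ⟶ B'} {S : A' ⟶ B'} {T : B' ⟶ A'} (h : i.hom ≫ b = a ≫ S)
    (hST : S ≫ T = 𝟙 _) : i.inv ≫ a = b ≫ T := by
  rw [Iso.inv_comp_eq, reassoc_of% h, hST, Category.comp_id]

theorem det_comp_det {X Y Z : FinSpace} (f : X → Y) (g : Y → Z) :
    (SubStoch.det f).comp (SubStoch.det g) = SubStoch.det fun x => g (f x) :=
  SubStoch.ev_ext fun x φ => by simp only [SubStoch.ev_comp, SubStoch.ev_det]

theorem infer_det_comp {R : DiagCongr} {X Y : FinSpace} (f : X → Y) (g : Y → X)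
    (h : ∀ x, g (f x) = x) :
    infer (R := R) (SubStoch.det f) ≫ infer (SubStoch.det g) = 𝟙 _ := by
  rw [← infer_comp, det_comp_det, ← infer_id]
  simp only [h, SubStoch.id]

section

variable {R : DiagCongr} {A B C : Theory R} {X Y Z : FinSpace}

theorem comp_infer_id (f : A ⟶ ⟨.inf X⟩) : f ≫ infer (SubStoch.id X) = f := by
  rw [infer_id, Category.comp_id]

/-- With `observeAll` for `f`, `g` and `h`, this is the associator case of `proc_observeAll`; the
unitor lemmas below play the same role. -/
theorem associator_infWires (f : A ⟶ ⟨.inf X⟩) (g : B ⟶ ⟨.inf Y⟩) (h : C ⟶ ⟨.inf Z⟩) :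
    (α_ A B C).hom ≫ (f ⊗ₘ ((g ⊗ₘ h) ≫ (infWires Y Z).inv)) ≫ (infWires X _).inv =
      ((((f ⊗ₘ g) ≫ (infWires X Y).inv) ⊗ₘ h) ≫ (infWires _ Z).inv) ≫
        infer (SubStoch.assoc X Y Z) := by
  rw [infer_assoc, Category.assoc, Iso.inv_hom_id_assoc, tensorHom_comp_tensorHom_assoc,
    Category.assoc, Iso.inv_hom_id, Category.comp_id, Category.comp_id, associator_naturality_assoc,
    tensorHom_comp_tensorHom_assoc, Category.comp_id]

theorem leftUnitor_infWires (f : A ⟶ ⟨.inf X⟩) : (λ_ A).hom ≫ f =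
    ((infUnit.inv ⊗ₘ f) ≫ (infWires star X).inv) ≫ infer (SubStoch.leftUnitor X) := by
  rw [infer_leftUnitor, Category.assoc, Iso.inv_hom_id_assoc, tensorHom_comp_tensorHom_assoc,
    Iso.inv_hom_id, Category.comp_id, id_tensorHom, leftUnitor_naturality]

theorem rightUnitor_infWires (f : A ⟶ ⟨.inf X⟩) : (ρ_ A).hom ≫ f =
    ((f ⊗ₘ infUnit.inv) ≫ (infWires X star).inv) ≫ infer (SubStoch.rightUnitor X) := by
  rw [infer_rightUnitor, Category.assoc, Iso.inv_hom_id_assoc, tensorHom_comp_tensorHom_assoc,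
    Iso.inv_hom_id, Category.comp_id, tensorHom_id, rightUnitor_naturality]

end

/-- Observing after a process is the same as observing before it and reading causal wires as
inferential ones. -/
theorem proc_observeAll {R : DiagCongr} {A B : Sys} (f : Diag A B) :
    proc R f ≫ observeAll B = observeAll A ≫ infer f.sem := by
  -- These squares are stated outside the induction because each serves two constructors, a wiring
  -- and its inverse.
  have hassoc (A B C : Sys) : (α_ (⟨A⟩ : Theory R) ⟨B⟩ ⟨C⟩).hom ≫
      observeAll (A.tensor (B.tensor C)) =
        observeAll ((A.tensor B).tensor C) ≫ infer (SubStoch.assoc _ _ _) :=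
    associator_infWires _ _ _
  have hleft (A : Sys) : (λ_ (⟨A⟩ : Theory R)).hom ≫ observeAll A =
      observeAll (Sys.unit.tensor A) ≫ infer (SubStoch.leftUnitor _) :=
    leftUnitor_infWires _
  have hright (A : Sys) : (ρ_ (⟨A⟩ : Theory R)).hom ≫ observeAll A =
      observeAll (A.tensor Sys.unit) ≫ infer (SubStoch.rightUnitor _) :=
    rightUnitor_infWires _
  have hinf (X Y : FinSpace) : (infWires (R := R) X Y).hom ≫
      observeAll ((Sys.inf X).tensor (.inf Y)) =
        observeAll (.inf (X.prod Y)) ≫ infer (SubStoch.id (X.prod Y)) := by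
    refine Eq.trans ?_ (comp_infer_id _).symm
    change (infWires X Y).hom ≫ (𝟙 _ ⊗ₘ 𝟙 _) ≫ (infWires X Y).inv = 𝟙 _
    rw [id_tensorHom_id, Category.id_comp, Iso.hom_inv_id]
  have hinfUnit : (infUnit (R := R)).hom ≫ observeAll Sys.unit =
      observeAll (.inf star) ≫ infer (SubStoch.id star) :=
    infUnit.hom_inv_id.trans (comp_infer_id _).symm
  have hcaus (L M : FinSpace) : (causWires (R := R) L M).hom ≫
      observeAll ((Sys.caus L).tensor (.caus M)) =
        observeAll (.caus (L.prod M)) ≫ infer (SubStoch.id (L.prod M)) :=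
    (observe_prod L M).symm.trans (comp_infer_id _).symm
  have hcausUnit : (causUnit (R := R)).hom ≫ observeAll Sys.unit =
      observeAll (.caus star) ≫ infer (SubStoch.id star) :=
    observe_star.symm.trans (comp_infer_id _).symm
  have hid (X : FinSpace) : infer (R := R) (SubStoch.id X) ≫ infer (SubStoch.id X) = 𝟙 _ :=
    (comp_infer_id _).trans (infer_id X)
  induction f with
  | id A =>
    exact (Category.id_comp _).trans (comp_infer_id _).symm
  | comp f g hf hg =>
    change (proc R f ≫ proc R g) ≫ _ = _ ≫ infer (f.sem.comp g.sem)
    rw [Category.assoc, hg, reassoc_of% hf, infer_comp]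
  | tensor f g hf hg =>
    change (proc R f ⊗ₘ proc R g) ≫ _ = _ ≫ infer (f.sem.tensor g.sem)
    rw [infer_tensor, observeAll_tensor, observeAll_tensor, tensorHom_comp_tensorHom_assoc, hf, hg,
      Category.assoc, Iso.inv_hom_id_assoc, tensorHom_comp_tensorHom_assoc]
  | assoc A B C => exact hassoc A B C
  | assocInv A B C =>
    exact comp_inv_eq_of_hom_comp (hassoc A B C) (infer_det_comp _ _ fun _ => rfl)
  | leftUnitor A => exact hleft A
  | leftUnitorInv A =>
    exact comp_inv_eq_of_hom_comp (hleft A) (infer_det_comp _ _ fun _ => rfl)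
  | rightUnitor A => exact hright A
  | rightUnitorInv A =>
    exact comp_inv_eq_of_hom_comp (hright A) (infer_det_comp _ _ fun _ => rfl)
  | swap A B =>
    change (β_ (⟨A⟩ : Theory R) ⟨B⟩).hom ≫ _ = _ ≫ infer (SubStoch.swap _ _)
    rw [infer_swap, observeAll_tensor, observeAll_tensor, Category.assoc, Iso.inv_hom_id_assoc,
      ← BraidedCategory.braiding_naturality_assoc]
  | infSplit X Y => exact hinf X Y
  | infMerge X Y => exact comp_inv_eq_of_hom_comp (hinf X Y) (hid _)
  | infUnit => exact hinfUnit
  | infUnitInv => exact comp_inv_eq_of_hom_comp hinfUnit (hid _)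
  | causSplit X Y => exact hcaus X Y
  | causMerge X Y => exact comp_inv_eq_of_hom_comp (hcaus X Y) (hid _)
  | causUnit => exact hcausUnit
  | causUnitInv => exact comp_inv_eq_of_hom_comp hcausUnit (hid _)
  | infer S =>
    change infer S ≫ 𝟙 _ = 𝟙 _ ≫ infer S
    rw [Category.comp_id, Category.id_comp]
  | know L M =>
    exact (know_observe L M).trans (Category.assoc _ _ _).symm
  | learn L =>
    change learn L ≫ (𝟙 _ ⊗ₘ observe L) ≫ (infWires L L).inv =
      observe L ≫ infer (SubStoch.copy L)
    rw [← Category.assoc, learn_observe, Category.assoc, Category.assoc, Iso.hom_inv_id,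
      Category.comp_id]
  | ignore L =>
    change ignore L ≫ infUnit.inv = observe L ≫ infer (SubStoch.discard L)
    rw [← observe_discard, Category.assoc, Category.assoc, Iso.hom_inv_id, Category.comp_id]

end Theory

/-! ### Equal matrices imply inferential equivalence -/

/-- Processes with the same matrix are inferentially equivalent. -/
theorem InfEquiv.of_sem_eq {p : PredictionMap} {A B : Sys} {D E : (⟨A⟩ : FS) ⟶ ⟨B⟩}
    (h : sem D = sem E) : InfEquiv p D E := by
  intro U V W hU hV x y
  -- The closed composites are shown to be equal as processes of `FS`, so their predictions agree
  -- trivially. Since `V` is inferential, `observeAll V` can be cancelled.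
  have key : ∀ f g : (⟨U⟩ : FS) ⟶ ⟨V⟩, sem f = sem g → f = g := by
    intro f g hfg
    obtain ⟨f, rfl⟩ := proc_surj f
    obtain ⟨g, rfl⟩ := proc_surj g
    have := isIso_observeAll (R := rwCongr) hV
    rw [← cancel_mono (observeAll V), proc_observeAll, proc_observeAll]
    exact congrArg (fun S => observeAll U ≫ infer S) hfg
  refine congrArg (p.map hU hV) (key _ _ ?_)
  rw [sem_comp, sem_comp, sem_comp, sem_comp, sem_whiskerRight, sem_whiskerRight, h]

/-! ### Realization of a matrix by independent sampling -/

namespace SubStoch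

/-- The completion of a substochastic map by an additional outcome, which is accompanied by the
default value `d`. -/
def complete {Y M : FinSpace} {X : Type*} (T : X → Y.prod M → ℝ≥0) (d : M) (x : X) :
    Option Y × M → ℝ≥0
  | (some y, m) => T x (y, m)
  | (none, m) => if m = d then 1 - ∑ q, T x q else 0

theorem sum_complete {Y M : FinSpace} {X : Type*} (T : X → Y.prod M → ℝ≥0) (d : M) (x : X)
    (h : ∑ q, T x q ≤ 1) : ∑ q, complete T d x q = 1 := by
  have h' : ∑ q, T x q = ∑ y : Y, ∑ m : M, T x (y, m) :=
    Fintype.sum_prod_type (α₁ := Y) (α₂ := M) _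
  rw [Fintype.sum_prod_type, Fintype.sum_option]
  simp only [complete, Finset.sum_ite_eq', Finset.mem_univ, if_true]
  -- The subtraction in `complete` is truncated; substochasticity makes it exact.
  rw [← h', tsub_add_cancel_of_le h]

/-- Independent samples of `Q l`, for all `l`, drawn from pairs. -/
theorem sum_prod_pair {L α β : Type*} [Fintype L] [DecidableEq L] [Fintype α] [Fintype β]
    [DecidableEq α] [DecidableEq β] (Q : L → α × β → ℝ≥0) :
    ∑ r : (L → α) × (L → β), ∏ l, Q l (r.1 l, r.2 l) = ∏ l, ∑ q, Q l q := by
  rw [Fintype.prod_sum]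
  exact Fintype.sum_equiv (Equiv.arrowProdEquivProdArrow L (fun _ => α) (fun _ => β)).symm _ _
    fun _ => rfl

/-- The marginal of independent samples at `l₀`. -/
theorem sum_prod_pair_mul {L α β : Type*} [Fintype L] [DecidableEq L] [Fintype α] [Fintype β]
    [DecidableEq α] [DecidableEq β] (Q : L → α × β → ℝ≥0) (hQ : ∀ l, ∑ q, Q l q = 1) (l₀ : L)
    (φ : α × β → ℝ≥0) :
    ∑ r : (L → α) × (L → β), (∏ l, Q l (r.1 l, r.2 l)) * φ (r.1 l₀, r.2 l₀) =
      ∑ q, Q l₀ q * φ q := by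
  -- Only the weights at `l₀` are multiplied by `φ`; after factorization every other factor is a
  -- total mass, equal to 1.
  have h := sum_prod_pair fun l q => Q l q * if l = l₀ then φ q else 1
  rw [Finset.prod_eq_single l₀ (by intro l _ hl; simp [hl, hQ]) (by simp)] at h
  simpa only [Finset.prod_mul_distrib, Finset.prod_ite_eq', Finset.mem_univ, if_true] using h

end SubStoch

open SubStoch in
/-- Every matrix is the matrix of a normal form: `Z` is a function from `L` to the outputs, and
the functions from `L` to `Option Y` and to `M` are sampled independently at each point of `L`. -/
theorem exists_coreForm {X Y L M : FinSpace} (hLM : Nonempty L → Nonempty M)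
    (T : SubStoch (X.prod L) (Y.prod M)) :
    ∃ (Z : FinSpace) (S : SubStoch X (Z.prod (fn L M))) (P : Z × L → Option Y),
      S.IsStochastic ∧ sem (coreForm S (SubStoch.ofPartial (X := Z.prod L) P)) = T := by
  -- A state must be supplied even with the outcome `none`, since the sampled function is total.
  -- Choosing it from the point `l` also covers empty `L`.
  let d : L → M := fun l => (hLM ⟨l⟩).some
  let Q : X → L → Option Y × M → ℝ≥0 := fun x l => complete (Y := Y) (M := M)
    (fun l : L => T.val (x, l)) (d l) l
  have hQ : ∀ x l, ∑ q, Q x l q = 1 := fun x l => sum_complete _ _ _ (T.sum_le (x, l))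
  let Z : FinSpace := ⟨L → Option Y⟩
  have hS : ∀ x : X, ∑ r : (L → Option Y) × (L → M), ∏ l, Q x l (r.1 l, r.2 l) = 1 := by
    intro x
    rw [sum_prod_pair]
    exact Finset.prod_eq_one fun l _ => hQ x l
  let S : SubStoch X (Z.prod (fn L M)) := ⟨fun x r => ∏ l, Q x l (r.1 l, r.2 l), fun x => (hS x).le⟩
  -- The propositional map evaluates the sampled outcome function at the learned state, and is
  -- undefined where the value is `none`.
  refine ⟨Z, S, fun r => r.1 r.2, hS, ev_ext fun x φ => ?_⟩
  -- An explicit diagram for `coreForm` makes it possible to compute the weighted sum along the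
  -- wires with `Diag.ev`.
  refine (Diag.sem_ev ((((Diag.infer S).comp (Diag.infSplit Z (fn L M))).tensor
    (Diag.learn L)).comp ((Diag.midSwap _ _ _ _).comp
      (((Diag.infMerge Z L).comp (Diag.infer (ofPartial (X := Z.prod L) fun r => r.1 r.2))).tensor
        (Diag.know L M)))) x φ).trans ?_
  have hP : ∀ (z : Z) (l : L) (ψ : Y → ℝ≥0),
      (ofPartial (X := Z.prod L) (Y := Y) fun r => r.1 r.2).ev (z, l) ψ = (z l).elim 0 ψ := by
    intro z l ψ
    change ∑ y, (if z l = some y then 1 else 0) * ψ y = _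
    cases z l <;> simp
  obtain ⟨x, l₀⟩ := x
  simp only [Diag.ev, Diag.midSwap]
  change (∑ r : (L → Option Y) × (L → M), (∏ l, Q x l (r.1 l, r.2 l)) *
    (ofPartial (X := Z.prod L) (Y := Y) fun r => r.1 r.2).ev (r.1, l₀) fun y => φ (y, r.2 l₀)) = _
  refine (Finset.sum_congr rfl fun r _ => congrArg _ (hP r.1 l₀ _)).trans ?_
  -- The integrand depends on the two sampled functions only through their values at `l₀`. The part
  -- of the marginal on `none` is multiplied by 0, and the rest is `T`.
  refine (sum_prod_pair_mul (Q x) (hQ x) l₀ fun q => q.1.elim 0 fun y => φ (y, q.2)).trans ?_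
  rw [Fintype.sum_prod_type, Fintype.sum_option]
  simp only [Option.elim, mul_zero, Finset.sum_const_zero, zero_add]
  exact (Fintype.sum_prod_type (α₁ := Y) (α₂ := M) fun q => T.val (x, l₀) q * φ q).symm

/-! ### Passage to the quotiented theory and conclusion -/

namespace Theory

/-- The quotient map from `FS` to the theory of a congruence. -/
def ofFS (R : DiagCongr) {A B : Sys} (f : (⟨A⟩ : FS) ⟶ ⟨B⟩) : (⟨A⟩ : Theory R) ⟶ ⟨B⟩ :=
  Quotient.map' (s₁ := rwCongr.setoid A B) (s₂ := R.setoid A B) (fun d => d)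
    (fun _ _ h => R.of_rw h) f

theorem ofFS_comp (R : DiagCongr) {A B C : Sys} (f : (⟨A⟩ : FS) ⟶ ⟨B⟩) (g : (⟨B⟩ : FS) ⟶ ⟨C⟩) :
    ofFS R (f ≫ g) = ofFS R f ≫ ofFS R g := by
  obtain ⟨f, rfl⟩ := proc_surj f
  obtain ⟨g, rfl⟩ := proc_surj g
  rfl

theorem ofFS_tensor (R : DiagCongr) {A B A' B' : Sys} (f : (⟨A⟩ : FS) ⟶ ⟨B⟩)
    (g : (⟨A'⟩ : FS) ⟶ ⟨B'⟩) :
    ofFS R (A := A.tensor A') (B := B.tensor B') (f ⊗ₘ g) = ofFS R f ⊗ₘ ofFS R g := by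
  obtain ⟨f, rfl⟩ := proc_surj f
  obtain ⟨g, rfl⟩ := proc_surj g
  rfl

theorem ofFS_gather_hom (R : DiagCongr) (A : Sys) : ofFS R (gather A).hom = (gather A).hom := by
  induction A with
  | tensor A B hA hB =>
    change _ = ((gather A).hom ⊗ₘ (gather B).hom) ≫ (midSwap _ _ _ _).hom ≫
      ((infWires _ _).inv ⊗ₘ (causWires _ _).inv)
    rw [← hA, ← hB, ← ofFS_tensor]
    exact ofFS_comp _ _ _
  | _ => rfl

/-- The quotient map respects composition and identities, so this follows from `ofFS_gather_hom` by
uniqueness of inverses. -/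
theorem ofFS_gather_inv (R : DiagCongr) (A : Sys) : ofFS R (gather A).inv = (gather A).inv := by
  rw [← cancel_epi (gather A).hom, Iso.hom_inv_id, ← ofFS_gather_hom]
  exact (ofFS_comp _ _ _).symm.trans (congrArg (ofFS R) (gather A).hom_inv_id)

theorem ofFS_normalForm (R : DiagCongr) {A B : Sys} {Z : FinSpace}
    (S : SubStoch A.infPart (Z.prod (fn A.causPart B.causPart)))
    (P : Z × A.causPart → Option B.infPart) : ofFS R (normalForm S P) = normalForm S P := by
  refine (ofFS_comp _ _ _).trans (congrArg₂ (· ≫ ·) (ofFS_gather_hom R A) ?_)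
  exact (ofFS_comp _ _ _).trans (congrArg₂ (· ≫ ·) rfl (ofFS_gather_inv R B))

end Theory

/-- Conjugating `D` by `gather` reduces to one wire of each kind, where `exists_coreForm` applies.
The core form has the matrix of the conjugate, and functoriality of `sem` carries this back through
the gathering wires. -/
theorem exists_infEquiv_normalForm (p : PredictionMap) {A B : Sys}
    (hAB : Nonempty A.causPart → Nonempty B.causPart) (D : (⟨A⟩ : FS) ⟶ ⟨B⟩) :
    ∃ (Z : FinSpace) (S : SubStoch A.infPart (Z.prod (fn A.causPart B.causPart)))
      (P : Z × A.causPart → Option B.infPart), S.IsStochastic ∧ InfEquiv p D (normalForm S P) := by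
  obtain ⟨Z, S, P, hS, h⟩ := exists_coreForm hAB
    (sem ((gather A).inv ≫ D ≫ (gather B).hom))
  refine ⟨Z, S, P, hS, .of_sem_eq ?_⟩
  have e : D = (gather A).hom ≫ ((gather A).inv ≫ D ≫ (gather B).hom) ≫ (gather B).inv := by
    simp
  have key (F : (⟨.inf A.infPart⟩ : FS) ⊗ ⟨.caus A.causPart⟩ ⟶
      ⟨.inf B.infPart⟩ ⊗ ⟨.caus B.causPart⟩) :
      sem ((gather A).hom ≫ F ≫ (gather B).inv) =
        (sem (gather A).hom).comp ((sem F).comp (sem (gather B).inv)) := by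
    rw [sem_comp, sem_comp]
  exact (congrArg sem e).trans ((key _).trans ((congrArg
    (fun T => (sem (gather A).hom).comp (T.comp (sem (gather B).inv))) h.symm).trans
      (key _).symm))

end CausalInf

theorem theorem5 (p : PredictionMap) (A B : Sys)
    (hAB : Nonempty A.causPart → Nonempty B.causPart) :
    (∀ D : (⟨A⟩ : FS) ⟶ ⟨B⟩,
      ∃ (Z : FinSpace) (S : SubStoch A.infPart (Z.prod (FinSpace.fn A.causPart B.causPart)))
        (P : Z × A.causPart → Option B.infPart),
        S.IsStochastic ∧ InfEquiv p D (Theory.normalForm S P)) ∧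
    (∀ D : (⟨A⟩ : QuotientFS p) ⟶ ⟨B⟩,
      ∃ (Z : FinSpace) (S : SubStoch A.infPart (Z.prod (FinSpace.fn A.causPart B.causPart)))
        (P : Z × A.causPart → Option B.infPart),
        S.IsStochastic ∧ D = Theory.normalForm S P) := by
  refine ⟨exists_infEquiv_normalForm p hAB, fun D => ?_⟩
  obtain ⟨d, rfl⟩ := Theory.proc_surj D
  obtain ⟨Z, S, P, hS, h⟩ := exists_infEquiv_normalForm p hAB (Theory.proc rwCongr d)
  refine ⟨Z, S, P, hS, ?_⟩
  -- `infCongr` relates diagrams, so a diagram `e` representing the normal form is chosen; the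
  -- equivalence of `d` and `e` is then literally the relation that is quotiented out.
  obtain ⟨e, he⟩ := Theory.proc_surj (Theory.normalForm (R := rwCongr) S P)
  rw [← Theory.ofFS_normalForm, ← he]
  rw [← he] at h
  exact Quotient.sound h
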